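/- Let $m\ge 1$ be an integer, let $\lambda$ be Lebesgue measure on $\mathbb R^m$, let $|\cdot|$ be the Euclidean norm and $B(r)=\{x\in\mathbb R^m:|x|<r\}$. Let $E\subset\mathbb R^m$ be a Lebesgue measurable set of zero relative Lebesgue density, that is, $$\lim_{r\to+\infty}\frac{\lambda\bigl(E\cap B(r)\bigr)}{r^m}=0 .$$ Let $f\colon\mathbb R^m\to\mathbb R$ be a function that is convex or harmonic on $\mathbb R^m$ and has finite order, in the sense that $$\limsup_{|x|\to\infty}\frac{\ln\bigl(1+f^+(x)\bigr)}{\ln|x|}<+\infty,\qquad f^+:=\max\{0,f\}.$$ If $f$ is bounded above on $\mathbb R^m\setminus E$, then $f$ is constant. -/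

import Mathlib

open MeasureTheory Filter Topology

noncomputable section

/-- The order (near infinity) of a real function `f` on `ℝ^m`,
`limsup_{|x| → ∞} log (1 + f⁺ x) / log |x|`, as an extended real number. -/
def growthOrder {m : ℕ} (f : EuclideanSpace ℝ (Fin m) → ℝ) : EReal :=
  limsup (fun x : EuclideanSpace ℝ (Fin m) =>
    ((Real.log (1 + max 0 (f x)) / Real.log ‖x‖ : ℝ) : EReal))
    (Bornology.cobounded (EuclideanSpace ℝ (Fin m)))

/-- `f` has finite order. -/
def IsOfFiniteOrder {m : ℕ} (f : EuclideanSpace ℝ (Fin m) → ℝ) : Prop :=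
  growthOrder f < ⊤

/-- `E ⊆ ℝ^m` is Lebesgue measurable and the limit `lim_{r → +∞} λ(E ∩ B(r)) / r^m`
exists and equals `d`. The measure of `E ∩ B(r)` is finite, so taking it as a real number loses
nothing. -/
def HasRelativeLebesgueDensity {m : ℕ} (E : Set (EuclideanSpace ℝ (Fin m))) (d : ℝ) : Prop :=
  NullMeasurableSet E volume ∧
    Tendsto (fun r : ℝ => volume.real (E ∩ Metric.ball 0 r) / r ^ m) atTop (𝓝 d)

end

/-! Let `M` bound `f` off `E`. Convex and harmonic functions satisfy a sub-mean value inequality for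
a fixed compactly supported radial weight, hence so does `u = max 0 (f - M)`, which is positive only
on `E`. Averaging at scale `R` bounds `u` on the ball of radius `R` by its supremum on the ball of
radius `3 * R` times the density of `{u > 0}` there, up to a constant
(`HasSubMeanValue.mul_le_mul_measureReal`). Passing to `3 * R` costs only `3 ^ N` under polynomial
growth, so a small density halves the growth constant; iterating gives `u = 0`
(`HasSubMeanValue.eq_zero_of_density`). Thus `f ≤ M` everywhere, and Liouville's theorem, convex or
harmonic, finishes. -/

/-- The cutoff profile `s ↦ max 0 (min 1 (2 - s))`, which is `1` for `s ≤ 1` and `0` for `2 ≤ s`. -/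
def cutoff (s : ℝ) : ℝ := max 0 (min 1 (2 - s))

lemma continuous_cutoff : Continuous cutoff := by unfold cutoff; fun_prop

lemma cutoff_nonneg (s : ℝ) : 0 ≤ cutoff s := le_max_left _ _

lemma cutoff_le_one (s : ℝ) : cutoff s ≤ 1 := max_le zero_le_one (min_le_left _ _)

lemma cutoff_of_le_one {s : ℝ} (hs : s ≤ 1) : cutoff s = 1 := by
  rw [cutoff, min_eq_left (by linarith), max_eq_right zero_le_one]

lemma cutoff_of_two_le {s : ℝ} (hs : 2 ≤ s) : cutoff s = 0 := by
  rw [cutoff, max_eq_left]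
  exact (min_le_right _ _).trans (by linarith)

/-- The antiderivative of `cutoff` vanishing on `[2, ∞)`. -/
noncomputable def cutoffPrimitive (s : ℝ) : ℝ := ∫ t in (2 : ℝ)..s, cutoff t

lemma hasDerivAt_cutoffPrimitive (s : ℝ) : HasDerivAt cutoffPrimitive (cutoff s) s :=
  intervalIntegral.integral_hasDerivAt_right (continuous_cutoff.intervalIntegrable _ _)
    continuous_cutoff.stronglyMeasurable.stronglyMeasurableAtFilter continuous_cutoff.continuousAt

lemma cutoffPrimitive_of_two_le {s : ℝ} (hs : 2 ≤ s) : cutoffPrimitive s = 0 := by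
  rw [cutoffPrimitive, intervalIntegral.integral_congr (g := fun _ => 0),
    intervalIntegral.integral_zero]
  intro t ht
  rw [Set.uIcc_of_le hs] at ht
  exact cutoff_of_two_le ht.1

/-! ### Radial weight and the weighted mean value property -/

section Kernel

variable {V : Type*} [NormedAddCommGroup V]

/-- The radial kernel `y ↦ cutoff (‖y‖ ^ 2)`. -/
noncomputable def radialKernel (y : V) : ℝ := cutoff (‖y‖ ^ 2)

lemma continuous_radialKernel : Continuous (radialKernel : V → ℝ) :=
  continuous_cutoff.comp (by fun_prop)

lemma radialKernel_nonneg (y : V) : 0 ≤ radialKernel y := cutoff_nonneg _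

lemma radialKernel_le_one (y : V) : radialKernel y ≤ 1 := cutoff_le_one _

lemma radialKernel_neg (y : V) : radialKernel (-y) = radialKernel y := by simp [radialKernel]

lemma radialKernel_of_norm_le_one {y : V} (hy : ‖y‖ ≤ 1) : radialKernel y = 1 :=
  cutoff_of_le_one (by nlinarith [norm_nonneg y])

lemma radialKernel_of_two_le_norm {y : V} (hy : 2 ≤ ‖y‖) : radialKernel y = 0 :=
  cutoff_of_two_le (by nlinarith)

variable [InnerProductSpace ℝ V]

/-- Makes the field `radialKernel y • y` half the gradient of a compactly supported function, ready
for integration by parts. -/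
lemma hasFDerivAt_cutoffPrimitive_norm_sq (y : V) :
    HasFDerivAt (fun z : V => cutoffPrimitive (‖z‖ ^ 2))
      (radialKernel y • (2 • innerSL ℝ y)) y :=
  (hasDerivAt_cutoffPrimitive _).comp_hasFDerivAt y (hasStrictFDerivAt_norm_sq y).hasFDerivAt

variable [FiniteDimensional ℝ V]

lemma hasCompactSupport_of_two_le_norm {g : V → ℝ} (hg : ∀ y, 2 ≤ ‖y‖ → g y = 0) :
    HasCompactSupport g := by
  refine HasCompactSupport.intro (isCompact_closedBall 0 2) fun y hy => hg y ?_
  simp only [Metric.mem_closedBall, dist_zero_right, not_le] at hy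
  exact hy.le

variable [MeasurableSpace V] [BorelSpace V]

lemma integrable_radialKernel_mul {g : V → ℝ} (hg : Continuous g) :
    Integrable (fun y => radialKernel y * g y) :=
  (continuous_radialKernel.mul hg).integrable_of_hasCompactSupport
    (hasCompactSupport_of_two_le_norm fun y hy => by
      rw [Pi.mul_apply, radialKernel_of_two_le_norm hy, zero_mul])

lemma integrable_radialKernel : Integrable (radialKernel : V → ℝ) := by
  simpa using integrable_radialKernel_mul (V := V) (g := fun _ => 1) continuous_const

lemma integral_radialKernel_pos : 0 < ∫ y : V, radialKernel y := by
  refine continuous_radialKernel.integral_pos_of_hasCompactSupport_nonneg_nonzero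
    (hasCompactSupport_of_two_le_norm fun y hy => radialKernel_of_two_le_norm hy)
    radialKernel_nonneg (x := 0) ?_
  rw [radialKernel_of_norm_le_one (by simp)]
  exact one_ne_zero

/-- The radial part of the gradient of a harmonic function has vanishing weighted mean. -/
lemma integral_radialKernel_mul_fderiv_eq_zero {f : V → ℝ} (hf : ContDiff ℝ 2 f)
    (hΔ : ∀ x, Laplacian.laplacian f x = 0) (x : V) (t : ℝ) :
    ∫ y, radialKernel y * fderiv ℝ f (x + t • y) y = 0 := by
  set b := stdOrthonormalBasis ℝ V
  have hf1 : ContDiff ℝ 1 (fderiv ℝ f) := hf.fderiv_right (by norm_num)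
  have hf1d : Differentiable ℝ (fderiv ℝ f) := hf1.differentiable one_ne_zero
  have hP : Continuous (fun z : V => cutoffPrimitive (‖z‖ ^ 2)) :=
    continuous_iff_continuousAt.2 fun z => (hasFDerivAt_cutoffPrimitive_norm_sq z).continuousAt
  have hPs : ∀ z : V, 2 ≤ ‖z‖ → cutoffPrimitive (‖z‖ ^ 2) = 0 := fun z hz =>
    cutoffPrimitive_of_two_le (by nlinarith)
  have hg : ∀ i y, HasFDerivAt (fun y => fderiv ℝ f (x + t • y) (b i))
      (t • (fderiv ℝ (fderiv ℝ f) (x + t • y)).flip (b i)) y := by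
    intro i y
    have h1 : HasFDerivAt (fun y : V => x + t • y) (t • ContinuousLinearMap.id ℝ V) y :=
      ((hasFDerivAt_id y).const_smul t).const_add x
    have h2 := ((hf1d (x + t • y)).hasFDerivAt.comp y h1).clm_apply (hasFDerivAt_const (b i) y)
    refine h2.congr_fderiv ?_
    ext v
    simp
  have hgc : ∀ i, Continuous (fun y => fderiv ℝ f (x + t • y) (b i)) := fun i =>
    continuous_iff_continuousAt.2 fun y => (hg i y).continuousAt
  have hf2c : Continuous (fderiv ℝ (fderiv ℝ f)) := hf1.continuous_fderiv one_ne_zero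
  have hg'c : ∀ i, Continuous
      (fun y => (t • (fderiv ℝ (fderiv ℝ f) (x + t • y)).flip (b i)) (b i)) := fun i => by
    simp only [smul_apply, ContinuousLinearMap.flip_apply]
    fun_prop
  have hint : ∀ i, Integrable (fun y =>
      ((t • (fderiv ℝ (fderiv ℝ f) (x + t • y)).flip (b i)) (b i)) *
        cutoffPrimitive (‖y‖ ^ 2)) := fun i =>
    ((hg'c i).mul hP).integrable_of_hasCompactSupport
      (hasCompactSupport_of_two_le_norm fun y hy => by
        rw [Pi.mul_apply, hPs y hy, mul_zero])
  -- Compact support kills the boundary terms; summed over `i`, the right side contains `t` times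
  -- the Laplacian.
  have hparts : ∀ i, ∫ y, fderiv ℝ f (x + t • y) (b i) *
      (radialKernel y • (2 • innerSL ℝ y)) (b i) =
      - ∫ y, ((t • (fderiv ℝ (fderiv ℝ f) (x + t • y)).flip (b i)) (b i)) *
        cutoffPrimitive (‖y‖ ^ 2) := by
    intro i
    refine integral_bilinear_hasFDerivAt_right_eq_neg_left_of_integrable
      (B := ContinuousLinearMap.mul ℝ ℝ) (v := b i) (hint i) ?_ ?_ (fun y _ => hg i y)
      (fun y _ => hasFDerivAt_cutoffPrimitive_norm_sq y)
    · have := integrable_radialKernel_mul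
        (g := fun y : V => fderiv ℝ f (x + t • y) (b i) * (2 * inner ℝ y (b i)))
        ((hgc i).mul (by fun_prop))
      refine this.congr (Eventually.of_forall fun y => ?_)
      simp
      ring
    · exact ((hgc i).mul hP).integrable_of_hasCompactSupport
        (hasCompactSupport_of_two_le_norm fun y hy => by
        rw [Pi.mul_apply, hPs y hy, mul_zero])
  have hsplit : ∀ y, radialKernel y * fderiv ℝ f (x + t • y) y =
      ∑ i, (1 / 2) * (fderiv ℝ f (x + t • y) (b i) *
        (radialKernel y • (2 • innerSL ℝ y)) (b i)) := by
    intro y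
    have h (l : V →L[ℝ] ℝ) : l y = ∑ i, inner ℝ (b i) y * l (b i) := by
      conv_lhs => rw [← b.sum_repr' y]
      simp
    rw [h, Finset.mul_sum]
    refine Finset.sum_congr rfl fun i _ => ?_
    simp [real_inner_comm]
    ring
  simp_rw [hsplit]
  rw [integral_finsetSum]
  · simp_rw [integral_const_mul, hparts]
    rw [← Finset.mul_sum, Finset.sum_neg_distrib, ← integral_finsetSum _ fun i _ => hint i]
    simp_rw [← Finset.sum_mul]
    have : ∀ y, ∑ i, (t • (fderiv ℝ (fderiv ℝ f) (x + t • y)).flip (b i)) (b i) = 0 := by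
      intro y
      have := hΔ (x + t • y)
      rw [InnerProductSpace.laplacian_eq_iteratedFDeriv_stdOrthonormalBasis] at this
      simp only [iteratedFDeriv_two_apply, Matrix.cons_val_zero, Matrix.cons_val_one] at this
      simp only [smul_apply, ContinuousLinearMap.flip_apply, ← Finset.smul_sum]
      rw [this, smul_zero]
    simp_rw [this]
    simp
  · intro i _
    have := integrable_radialKernel_mul
      (g := fun y : V => fderiv ℝ f (x + t • y) (b i) * (inner ℝ y (b i)))
      ((hgc i).mul (by fun_prop))
    refine this.congr (Eventually.of_forall fun y => ?_)
    simp
    ring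

/-- **Mean value property**, with the weight `radialKernel`. -/
theorem integral_radialKernel_mul_of_laplacian_eq_zero {f : V → ℝ} (hf : ContDiff ℝ 2 f)
    (hΔ : ∀ x, Laplacian.laplacian f x = 0) (x : V) (t : ℝ) :
    ∫ y, radialKernel y * f (x + t • y) = (∫ y : V, radialKernel y) * f x := by
  have hfd : Differentiable ℝ f := hf.differentiable two_ne_zero
  have hfc : Continuous (fderiv ℝ f) := hf.continuous_fderiv two_ne_zero
  -- The weighted mean does not depend on the scale `t`, so it can be evaluated at `t = 0`.
  have hderiv : ∀ t : ℝ, HasDerivAt (fun t : ℝ => ∫ y, radialKernel y * f (x + t • y)) 0 t := by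
    intro t
    have hF'c : Continuous (fun p : ℝ × V => radialKernel p.2 * fderiv ℝ f (x + p.1 • p.2) p.2) :=
      (continuous_radialKernel.comp continuous_snd).mul (by fun_prop)
    obtain ⟨C, hC⟩ := ((isCompact_closedBall t 1).prod
      (isCompact_closedBall (0 : V) 2)).exists_bound_of_continuousOn hF'c.continuousOn
    have key := hasDerivAt_integral_of_dominated_loc_of_deriv_le (μ := (volume : Measure V))
      (F := fun t y => radialKernel y * f (x + t • y))
      (F' := fun t y => radialKernel y * fderiv ℝ f (x + t • y) y) (x₀ := t)
      (bound := (Metric.closedBall (0 : V) 2).indicator fun _ => C)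
      (Metric.closedBall_mem_nhds t one_pos)
      (Eventually.of_forall fun s => (integrable_radialKernel_mul
        (hf.continuous.comp (by fun_prop))).aestronglyMeasurable)
      (integrable_radialKernel_mul (hf.continuous.comp (by fun_prop)))
      (integrable_radialKernel_mul (by fun_prop)).aestronglyMeasurable
      (Eventually.of_forall fun y s hs => ?_) ?_
      (Eventually.of_forall fun y s _ => ?_)
    · rw [← integral_radialKernel_mul_fderiv_eq_zero hf hΔ x t]
      exact key.2
    · by_cases hy : y ∈ Metric.closedBall (0 : V) 2
      · rw [Set.indicator_of_mem hy]
        exact hC (s, y) ⟨hs, hy⟩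
      · rw [Set.indicator_of_notMem hy]
        rw [Metric.mem_closedBall, dist_zero_right, not_le] at hy
        simp [radialKernel_of_two_le_norm hy.le]
    · exact (integrable_indicator_iff measurableSet_closedBall).2
        (integrableOn_const (measure_closedBall_lt_top.ne))
    · have h1 : HasDerivAt (fun s : ℝ => x + s • y) y s := by
        simpa using ((hasDerivAt_id s).smul_const y).const_add x
      exact ((hfd (x + s • y)).hasFDerivAt.comp_hasDerivAt s h1).const_mul _
  have := is_const_of_deriv_eq_zero (fun s => (hderiv s).differentiableAt)
    (fun s => (hderiv s).deriv) t 0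
  rw [this]
  simp [integral_mul_const]

end Kernel

/-! ### Sub-mean value inequality and sets of zero density -/

section SubMean

variable {V : Type*} [NormedAddCommGroup V] [InnerProductSpace ℝ V] [FiniteDimensional ℝ V]
  [MeasurableSpace V] [BorelSpace V]

/-- The sub-mean value inequality with respect to the weight `radialKernel`. -/
def HasSubMeanValue (u : V → ℝ) : Prop :=
  ∀ (x : V) (t : ℝ), (∫ y : V, radialKernel y) * u x ≤ ∫ y, radialKernel y * u (x + t • y)

lemma HasSubMeanValue.of_laplacian_eq_zero {f : V → ℝ} (hf : ContDiff ℝ 2 f)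
    (hΔ : ∀ x, Laplacian.laplacian f x = 0) : HasSubMeanValue f := fun x t =>
  (integral_radialKernel_mul_of_laplacian_eq_zero hf hΔ x t).ge

/-- The kernel is even, so averaging the points `x ± t • y` reduces this to midpoint convexity. -/
lemma HasSubMeanValue.of_convexOn {f : V → ℝ} (hf : ConvexOn ℝ Set.univ f)
    (hc : Continuous f) : HasSubMeanValue f := by
  intro x t
  have h1 : Integrable fun y => radialKernel y * f (x + t • y) :=
    integrable_radialKernel_mul (hc.comp (by fun_prop))
  have h2 : Integrable fun y => radialKernel y * f (x + t • -y) :=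
    integrable_radialKernel_mul (hc.comp (by fun_prop))
  have h3 : ∫ y, radialKernel y * f (x + t • -y) = ∫ y, radialKernel y * f (x + t • y) := by
    rw [← integral_neg_eq_self (fun y => radialKernel y * f (x + t • y))]
    simp only [radialKernel_neg]
  have h4 : ∫ y : V, radialKernel y * (2 * f x) ≤
      ∫ y, (radialKernel y * f (x + t • y) + radialKernel y * f (x + t • -y)) := by
    refine integral_mono (integrable_radialKernel.mul_const _) (h1.add h2) fun y => ?_
    have h := hf.2 (Set.mem_univ (x + t • y)) (Set.mem_univ (x + t • -y))
      (by norm_num : (0 : ℝ) ≤ 1 / 2) (by norm_num : (0 : ℝ) ≤ 1 / 2) (by norm_num)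
    have hx : (1 / 2 : ℝ) • (x + t • y) + (1 / 2 : ℝ) • (x + t • -y) = x := by module
    rw [hx, smul_eq_mul, smul_eq_mul] at h
    have := radialKernel_nonneg y
    change radialKernel y * (2 * f x) ≤
      radialKernel y * f (x + t • y) + radialKernel y * f (x + t • -y)
    rw [← mul_add]
    exact mul_le_mul_of_nonneg_left (by linarith) this
  rw [integral_add h1 h2, h3, integral_mul_const] at h4
  linarith

lemma HasSubMeanValue.max_zero_sub {f : V → ℝ} (hf : HasSubMeanValue f) (hc : Continuous f)
    (M : ℝ) : HasSubMeanValue fun x => max 0 (f x - M) := by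
  intro x t
  have hint : Integrable fun y => radialKernel y * max 0 (f (x + t • y) - M) :=
    integrable_radialKernel_mul (by fun_prop)
  have hint' : Integrable fun y => radialKernel y * f (x + t • y) :=
    integrable_radialKernel_mul (by fun_prop)
  dsimp only
  rw [mul_max_of_nonneg _ _ integral_radialKernel_pos.le, mul_zero]
  refine max_le (integral_nonneg fun y => mul_nonneg (radialKernel_nonneg y) (le_max_left _ _)) ?_
  calc (∫ y : V, radialKernel y) * (f x - M)
      ≤ (∫ y, radialKernel y * f (x + t • y)) - (∫ y : V, radialKernel y) * M := by
        linarith [hf x t]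
    _ = ∫ y, (radialKernel y * f (x + t • y) - radialKernel y * M) := by
        rw [integral_sub hint' (integrable_radialKernel.mul_const _), integral_mul_const]
    _ ≤ _ := by
        refine integral_mono (hint'.sub (integrable_radialKernel.mul_const _)) hint fun y => ?_
        change radialKernel y * f (x + t • y) - radialKernel y * M ≤
          radialKernel y * max 0 (f (x + t • y) - M)
        rw [← mul_sub]
        exact mul_le_mul_of_nonneg_left (le_max_right _ _) (radialKernel_nonneg y)

lemma integral_comp_add_smul (h : V → ℝ) (x : V) {t : ℝ} (ht : 0 < t) :
    ∫ y, h (x + t • y) = (t ^ Module.finrank ℝ V)⁻¹ * ∫ y, h y := by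
  rw [Measure.integral_comp_smul volume (fun z => h (x + z)) t, integral_add_left_eq_self,
    abs_of_pos (by positivity), smul_eq_mul]

/-- The kernel at scale `R` around `x` sees only the ball of radius `3 * R` about `0`, where `u` is
at most `B` and contributes only where positive. -/
lemma HasSubMeanValue.mul_le_mul_measureReal {u : V → ℝ} (hu : HasSubMeanValue u)
    (hc : Continuous u) (h0 : ∀ x, 0 ≤ u x) {R B : ℝ} (hR : 0 < R) (hB : 0 ≤ B)
    (huB : ∀ z, ‖z‖ ≤ 3 * R → u z ≤ B) {x : V} (hx : ‖x‖ ≤ R) :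
    (∫ y : V, radialKernel y) * u x * R ^ Module.finrank ℝ V ≤
      B * volume.real ({z | 0 < u z} ∩ Metric.ball 0 (3 * R)) := by
  set S := {z | 0 < u z} ∩ Metric.ball (0 : V) (3 * R)
  have hS : MeasurableSet S :=
    (isOpen_lt continuous_const hc).measurableSet.inter measurableSet_ball
  have hSf : volume S ≠ ⊤ :=
    ((measure_mono Set.inter_subset_right).trans_lt measure_ball_lt_top).ne
  have hint : Integrable (S.indicator fun _ => B) :=
    (integrable_indicator_iff hS).2 (integrableOn_const hSf)
  have hint' : Integrable fun y => S.indicator (fun _ => B) (x + R • y) :=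
    (hint.comp_add_left x).comp_smul hR.ne'
  have key : (∫ y : V, radialKernel y) * u x ≤ ∫ y, S.indicator (fun _ => B) (x + R • y) := by
    refine (hu x R).trans (integral_mono_of_nonneg (Eventually.of_forall fun y =>
      mul_nonneg (radialKernel_nonneg y) (h0 _)) hint' (Eventually.of_forall fun y => ?_))
    have hind : 0 ≤ S.indicator (fun _ => B) (x + R • y) := Set.indicator_nonneg (fun _ _ => hB) _
    dsimp only
    rcases le_or_gt 2 ‖y‖ with hy | hy
    · rwa [radialKernel_of_two_le_norm hy, zero_mul]
    rcases (h0 (x + R • y)).eq_or_lt with h | h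
    · rwa [← h, mul_zero]
    have hlt : ‖x + R • y‖ < 3 * R := by
      refine (norm_add_le _ _).trans_lt ?_
      rw [norm_smul, Real.norm_of_nonneg hR.le]
      nlinarith
    rw [Set.indicator_of_mem (show x + R • y ∈ S from ⟨h, by simpa using hlt⟩)]
    exact (mul_le_of_le_one_left (h0 _) (radialKernel_le_one y)).trans (huB _ hlt.le)
  rw [integral_comp_add_smul _ _ hR, integral_indicator_const _ hS, smul_eq_mul,
    ← div_eq_inv_mul, le_div_iff₀ (by positivity)] at key
  linarith

/-- A nonnegative function of polynomial growth with the sub-mean value property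
which is positive only on a set of zero density vanishes. -/
theorem HasSubMeanValue.eq_zero_of_density {u : V → ℝ} (hu : HasSubMeanValue u)
    (hc : Continuous u) (h0 : ∀ x, 0 ≤ u x) {C : ℝ} {N : ℕ} (hC : 0 ≤ C)
    (hgrowth : ∀ R : ℝ, 1 ≤ R → ∀ z, ‖z‖ ≤ R → u z ≤ C * R ^ N)
    (hdens : Tendsto (fun r : ℝ => volume.real ({z | 0 < u z} ∩ Metric.ball 0 r) /
      r ^ Module.finrank ℝ V) atTop (𝓝 0)) (x : V) : u x = 0 := by
  set d := Module.finrank ℝ V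
  set I := ∫ y : V, radialKernel y
  have hI : 0 < I := integral_radialKernel_pos
  -- `3 ^ d` absorbs the larger ball, `3 ^ N` the growth from `R` to `3 * R`, and `2` leaves the
  -- gain of one half.
  set δ : ℝ := I / (3 ^ d * (2 * 3 ^ N))
  have hδ : 0 < δ := by positivity
  obtain ⟨R₁, hR₁⟩ := eventually_atTop.1 (hdens.eventually (gt_mem_nhds hδ))
  have step : ∀ n : ℕ, ∀ R : ℝ, max 1 R₁ ≤ R → ∀ z, ‖z‖ ≤ R →
      u z ≤ (1 / 2) ^ n * (C * R ^ N) := by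
    intro n
    induction n with
    | zero =>
      intro R hR z hz
      simpa using hgrowth R ((le_max_left _ _).trans hR) z hz
    | succ n ih =>
      intro R hR z hz
      have hR1 : 1 ≤ R := (le_max_left _ _).trans hR
      have hR2 : R₁ ≤ R := (le_max_right _ _).trans hR
      have hR0 : 0 < R := by linarith
      have hB : 0 ≤ (1 / 2) ^ n * (C * (3 * R) ^ N) := by positivity
      have h1 := hu.mul_le_mul_measureReal hc h0 hR0 hB (ih (3 * R) (by linarith)) hz
      have h2 := (hR₁ (3 * R) (by linarith)).le
      rw [div_le_iff₀ (by positivity)] at h2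
      have h3 := h1.trans (mul_le_mul_of_nonneg_left h2 hB)
      have h4 : (1 / 2) ^ n * (C * (3 * R) ^ N) * (δ * (3 * R) ^ d) =
          I * ((1 / 2) ^ (n + 1) * (C * R ^ N)) * R ^ d := by
        simp only [δ]
        field_simp
        ring
      rw [h4] at h3
      exact le_of_mul_le_mul_left (le_of_mul_le_mul_right h3 (by positivity)) hI
  set R := max (max 1 R₁) ‖x‖
  have hlim : Tendsto (fun n : ℕ => (1 / 2 : ℝ) ^ n * (C * R ^ N)) atTop (𝓝 0) := by
    simpa using (tendsto_pow_atTop_nhds_zero_of_lt_one (r := (1 / 2 : ℝ)) (by norm_num)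
      (by norm_num)).mul_const (C * R ^ N)
  exact le_antisymm (ge_of_tendsto' hlim fun n => step n R (le_max_left _ _) x (le_max_right _ _))
    (h0 x)

/-! ### Liouville theorems -/

/-- **Harnack inequality** on the whole space. -/
lemma harnack_of_laplacian_eq_zero {g : V → ℝ} (hg : ContDiff ℝ 2 g)
    (hΔ : ∀ x, Laplacian.laplacian g x = 0) (h0 : ∀ x, 0 ≤ g x) (x y : V) :
    g x ≤ 3 ^ Module.finrank ℝ V * g y := by
  set d := Module.finrank ℝ V
  rcases eq_or_ne x y with rfl | hxy
  · exact le_mul_of_one_le_left (h0 x) (one_le_pow₀ (by norm_num))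
  set D := ‖x - y‖
  have hD : 0 < D := norm_pos_iff.2 (sub_ne_zero.2 hxy)
  have mean : ∀ (z : V) {t : ℝ}, 0 < t → Integrable (fun v => radialKernel (t⁻¹ • (v - z)) * g v) ∧
      ∫ v, radialKernel (t⁻¹ • (v - z)) * g v = t ^ d * ((∫ v : V, radialKernel v) * g z) := by
    intro z t ht
    constructor
    · have h := integrable_radialKernel_mul (V := V) (g := fun v => g (z + t • v))
        (hg.continuous.comp (by fun_prop))
      refine ((h.comp_smul (inv_ne_zero ht.ne')).comp_sub_right z).congr
        (Eventually.of_forall fun v => ?_)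
      simp [smul_smul, ht.ne']
    · have h := integral_comp_add_smul (fun v => radialKernel (t⁻¹ • (v - z)) * g v) z ht
      simp only [add_sub_cancel_left, smul_smul, inv_mul_cancel₀ ht.ne', one_smul] at h
      rw [integral_radialKernel_mul_of_laplacian_eq_zero hg hΔ] at h
      rw [h, mul_inv_cancel_left₀ (by positivity)]
  obtain ⟨-, hx⟩ := mean x hD
  -- Radius `3 * D` about `y` covers the ball of radius `2 * D` about `x`, so the wider kernel is
  -- `1` wherever the narrower one is nonzero.
  obtain ⟨hint, hy⟩ := mean y (mul_pos three_pos hD)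
  have hle : ∫ v, radialKernel (D⁻¹ • (v - x)) * g v ≤
      ∫ v, radialKernel ((3 * D)⁻¹ • (v - y)) * g v := by
    refine integral_mono_of_nonneg (Eventually.of_forall fun v =>
      mul_nonneg (radialKernel_nonneg _) (h0 v)) hint (Eventually.of_forall fun v => ?_)
    refine mul_le_mul_of_nonneg_right ?_ (h0 v)
    rcases le_or_gt 2 ‖D⁻¹ • (v - x)‖ with hv | hv
    · rw [radialKernel_of_two_le_norm hv]
      exact radialKernel_nonneg _
    · rw [norm_smul, norm_inv, Real.norm_of_nonneg hD.le, inv_mul_lt_iff₀ hD] at hv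
      refine (radialKernel_le_one _).trans (radialKernel_of_norm_le_one ?_).ge
      rw [norm_smul, norm_inv, Real.norm_of_nonneg (by positivity),
        inv_mul_le_iff₀ (by positivity), mul_one]
      have := norm_sub_le_norm_sub_add_norm_sub v x y
      change _ ≤ _ + D at this
      linarith
  rw [hx, hy, mul_pow] at hle
  have hI : 0 < ∫ v : V, radialKernel v := integral_radialKernel_pos
  refine le_of_mul_le_mul_left (a := D ^ d * ∫ v : V, radialKernel v) ?_ (by positivity)
  linarith

/-- **Liouville's theorem** for harmonic functions bounded above. -/
theorem eq_of_laplacian_eq_zero_of_le {f : V → ℝ} (hf : ContDiff ℝ 2 f)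
    (hΔ : ∀ x, Laplacian.laplacian f x = 0) {M : ℝ} (hM : ∀ x, f x ≤ M) (x y : V) :
    f x = f y := by
  have hbdd : BddAbove (Set.range f) := ⟨M, Set.forall_mem_range.2 hM⟩
  have hsup : ∀ x, f x = ⨆ z, f z := by
    intro x
    refine le_antisymm (le_ciSup hbdd x) ?_
    set s := ⨆ z, f z
    have hg : ContDiff ℝ 2 ((fun _ : V => s) - f) := contDiff_const.sub hf
    have hgΔ : ∀ z, Laplacian.laplacian ((fun _ : V => s) - f) z = 0 := fun z => by
      rw [ContDiffAt.laplacian_sub contDiff_const.contDiffAt hf.contDiffAt, hΔ]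
      simp
    -- Harnack for `s - f`: a gap below the supremum at `x` forces a uniform gap everywhere.
    have hH : ∀ z, f z ≤ s - (s - f x) / 3 ^ Module.finrank ℝ V := by
      intro z
      have := harnack_of_laplacian_eq_zero hg hgΔ (fun z => sub_nonneg.2 (le_ciSup hbdd z)) x z
      rw [← div_le_iff₀' (by positivity)] at this
      simp only [Pi.sub_apply] at this
      linarith
    have h1 : s ≤ s - (s - f x) / 3 ^ Module.finrank ℝ V := ciSup_le hH
    have h2 : (s - f x) / 3 ^ Module.finrank ℝ V ≤ 0 := by linarith
    rw [div_le_iff₀ (by positivity), zero_mul] at h2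
    linarith
  rw [hsup x, hsup y]

end SubMean

/-- A convex function on the whole space which is bounded above is constant. -/
theorem ConvexOn.eq_of_forall_le {V : Type*} [AddCommGroup V] [Module ℝ V] {f : V → ℝ}
    (hf : ConvexOn ℝ Set.univ f) {M : ℝ} (hM : ∀ x, f x ≤ M) (x y : V) : f x = f y := by
  have key : ∀ x y, f x ≤ f y := by
    intro x y
    have hlim : Tendsto (fun t : ℝ => (1 - t) * f y + t * M) (𝓝[>] 0) (𝓝 (f y)) := by
      refine tendsto_nhdsWithin_of_tendsto_nhds ?_
      have : Continuous fun t : ℝ => (1 - t) * f y + t * M := by fun_prop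
      simpa using this.tendsto 0
    refine ge_of_tendsto hlim ?_
    -- `x` divides the segment from `y` to a point receding to infinity as `t → 0`, where `f` is
    -- still at most `M`.
    filter_upwards [Ioo_mem_nhdsGT (zero_lt_one (α := ℝ))] with t ht
    have h := hf.2 (Set.mem_univ y) (Set.mem_univ (y + t⁻¹ • (x - y)))
      (sub_nonneg.2 ht.2.le) ht.1.le (sub_add_cancel 1 t)
    have hx : (1 - t) • y + t • (y + t⁻¹ • (x - y)) = x := by
      rw [smul_add, smul_smul, mul_inv_cancel₀ ht.1.ne']
      module
    rw [hx, smul_eq_mul, smul_eq_mul] at h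
    exact h.trans (by gcongr; exacts [ht.1.le, hM _])
  exact le_antisymm (key x y) (key y x)

/-! ### Finite order and conclusion -/

/-- A continuous function of finite order grows at most polynomially. -/
lemma IsOfFiniteOrder.exists_le_mul_pow {m : ℕ} {f : EuclideanSpace ℝ (Fin m) → ℝ}
    (hord : IsOfFiniteOrder f) (hc : Continuous f) :
    ∃ (C : ℝ) (N : ℕ), 0 ≤ C ∧ ∀ R : ℝ, 1 ≤ R → ∀ z, ‖z‖ ≤ R → f z ≤ C * R ^ N := by
  obtain ⟨K, hK, -⟩ := EReal.lt_iff_exists_real_btwn.1 hord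
  have hev := eventually_lt_of_limsup_lt hK
  simp only [EReal.coe_lt_coe_iff] at hev
  obtain ⟨r, -, hr⟩ := (Metric.hasBasis_cobounded_compl_closedBall
    (0 : EuclideanSpace ℝ (Fin m))).eventually_iff.1 hev
  obtain ⟨B, hB⟩ := (isCompact_closedBall (0 : EuclideanSpace ℝ (Fin m))
    (max 1 r)).exists_bound_of_continuousOn hc.continuousOn
  obtain ⟨N, hN⟩ := exists_nat_ge K
  -- `B` handles the compact ball; outside it `‖z‖ ^ N` suffices, with constant `1`.
  refine ⟨max 1 B, N, zero_le_one.trans (le_max_left _ _), fun R hR z hz => ?_⟩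
  have hRN : 1 ≤ R ^ N := one_le_pow₀ hR
  rcases le_or_gt ‖z‖ (max 1 r) with h | h
  · have h1 : f z ≤ B := (Real.le_norm_self _).trans (hB z (by simpa using h))
    exact (h1.trans (le_max_right _ _)).trans (le_mul_of_one_le_right (by positivity) hRN)
  · have h1 : 1 < ‖z‖ := (le_max_left _ _).trans_lt h
    have h2 := hr (x := z) (by simpa using (le_max_right _ _).trans_lt h)
    rw [div_lt_iff₀ (Real.log_pos h1)] at h2
    have h3 : Real.log (1 + max 0 (f z)) ≤ Real.log (‖z‖ ^ N) := by
      rw [Real.log_pow]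
      exact h2.le.trans (mul_le_mul_of_nonneg_right hN (Real.log_pos h1).le)
    rw [Real.log_le_log_iff (by positivity) (by positivity)] at h3
    calc f z ≤ max 0 (f z) := le_max_right _ _
      _ ≤ ‖z‖ ^ N := by linarith
      _ ≤ R ^ N := by gcongr
      _ ≤ max 1 B * R ^ N := le_mul_of_one_le_left (by positivity) (le_max_left _ _)

/-- A continuous function of finite order with the sub-mean value property that is bounded above
off a set of zero density is bounded above by the same constant everywhere. -/
theorem HasSubMeanValue.le_of_forall_notMem_le {m : ℕ} {E : Set (EuclideanSpace ℝ (Fin m))}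
    (hE : HasRelativeLebesgueDensity E 0) {f : EuclideanSpace ℝ (Fin m) → ℝ}
    (hf : HasSubMeanValue f) (hc : Continuous f) (hord : IsOfFiniteOrder f) {M : ℝ}
    (hM : ∀ x, x ∉ E → f x ≤ M) (x : EuclideanSpace ℝ (Fin m)) : f x ≤ M := by
  obtain ⟨C, N, hC, hgrowth⟩ := hord.exists_le_mul_pow hc
  have hsub : {z | 0 < max 0 (f z - M)} ⊆ E := by
    intro z hz
    by_contra hzE
    rw [Set.mem_ofPred_eq, max_eq_left (sub_nonpos.2 (hM z hzE))] at hz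
    exact lt_irrefl _ hz
  have h := (hf.max_zero_sub hc M).eq_zero_of_density (by fun_prop) (fun _ => le_max_left _ _)
    (C := C + |M|) (N := N) (by positivity) ?_ ?_ x
  · have := le_max_right 0 (f x - M)
    linarith
  · intro R hR z hz
    have h1 := hgrowth R hR z hz
    have h2 : 1 ≤ R ^ N := one_le_pow₀ hR
    have h3 : |M| ≤ |M| * R ^ N := le_mul_of_one_le_right (abs_nonneg _) h2
    refine max_le (by positivity) ?_
    linarith [neg_abs_le M]
  · rw [finrank_euclideanSpace_fin]
    refine squeeze_zero' ?_ ?_ hE.2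
    · filter_upwards [eventually_ge_atTop 0] with r hr
      positivity
    · filter_upwards [eventually_ge_atTop 0] with r hr
      refine div_le_div_of_nonneg_right (measureReal_mono (Set.inter_subset_inter_left _ hsub) ?_)
        (by positivity)
      exact ((measure_mono Set.inter_subset_right).trans_lt measure_ball_lt_top).ne

theorem mainTheorem3 (m : ℕ) (hm : 1 ≤ m) (E : Set (EuclideanSpace ℝ (Fin m)))
    (hE : HasRelativeLebesgueDensity E 0)
    (f : EuclideanSpace ℝ (Fin m) → ℝ)
    (hf : ConvexOn ℝ Set.univ f ∨ InnerProductSpace.HarmonicOnNhd f Set.univ)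
    (hord : IsOfFiniteOrder f)
    (hbdd : BddAbove (f '' Eᶜ)) :
    ∃ c : ℝ, ∀ x, f x = c := by
  obtain ⟨M, hM⟩ := hbdd
  have hM' : ∀ x, x ∉ E → f x ≤ M := fun x hx => hM (Set.mem_image_of_mem f hx)
  refine ⟨f 0, fun x => ?_⟩
  rcases hf with hf | hf
  · have hc : Continuous f := continuousOn_univ.1 (hf.continuousOn isOpen_univ)
    exact hf.eq_of_forall_le
      ((HasSubMeanValue.of_convexOn hf hc).le_of_forall_notMem_le hE hc hord hM') x 0
  · have hf2 : ContDiff ℝ 2 f := contDiffOn_univ.1 hf.contDiffOn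
    have hΔ : ∀ x, Laplacian.laplacian f x = 0 := fun x => (hf x (Set.mem_univ x)).2.self_of_nhds
    exact eq_of_laplacian_eq_zero_of_le hf2 hΔ
      ((HasSubMeanValue.of_laplacian_eq_zero hf2 hΔ).le_of_forall_notMem_le hE
        hf2.continuous hord hM') x 0
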